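/- Let $m,n\ge 1$ be integers and $d=\gcd(m,n)$. An $(m,n)$-invariant set is a set $\Delta\subset\mathbb Z$ with $\Delta+m\subset\Delta$ and $\Delta+n\subset\Delta$; all invariant sets below are bounded ($\min\Delta$ exists) and co-bounded ($\mathbb Z_{\ge k}\subset\Delta$ for some $k$). An element $a\in\Delta$ is a $k$-generator if $a-k\notin\Delta$; an integer $a\notin\Delta$ is a $k$-cogenerator if $a+k\in\Delta$. The skeleton of an $(m,n)$-invariant set is the union of its $m$-generators and its $n$-cogenerators. The set $\Delta$ is $0$-balanced if $\#(\mathbb Z_{\ge 0}\setminus\Delta)=\#(\mathbb Z_{<0}\cap\Delta)$. Let $[m]=\{0,\dots,m-1\}$. A letter $j\in[m]$ acts on $\Delta$ by $j\cdot\Delta=\Delta\setminus\{a_j\}$, where $a_0<\dots<a_{m-1}$ are the $m$-generators of $\Delta$; a word acts from right to left, $w_{n-1}\cdots w_0\cdot\Delta=w_{n-1}(\cdots(w_0\cdot\Delta))$. An $(m,n)$-parking function is a word $w_{n-1}\cdots w_0\in[m]^n$ with $\#\{j:w_j<i\}\ge in/m$ for $1\le i\le m$; it is monotone if $w_0\le\dots\le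 w_{n-1}$. The associated monotone parking function of an $(m,n)$-invariant set $\Delta$ is the (unique) monotone $(m,n)$-parking function $p$ with $p\cdot\Delta=\Delta+n$. For a tuple $\Theta=(\Delta_0,\dots,\Delta_{d-1})$ of $0$-balanced $(m/d,n/d)$-invariant sets with skeletons $S_0,\dots,S_{d-1}$, let $V=\{x\in\mathbb R^d:\sum_i x_i=0\}$, let $\Sigma_\Theta\subset V$ be the set of all $x\in V$ such that $(dS_i+x_i)\cap(dS_j+x_j)\ne\emptyset$ for some $i\ne j$, and put $\Delta_\Theta(x)=\bigcup_{i=0}^{d-1}(d\Delta_i+x_i)\subset\mathbb R$. Two $(m,n)$-invariant sets $\Delta,\Delta'$ are equivalent in the sense of Gorsky, Mazin and Vazirani, written $\Delta\sim\Delta'$, if there are such a tuple $\Theta$ and points $x,y$ in the same connected component of $V\setminus\Sigma_\Theta$ such that $\Delta_\Theta(x)$ is a translate of $\Delta$ and $\Delta_\Theta(y)$ is a translate of $\Delta'$ (translations by real numbers). **Lemma.** Let $\Delta$ and $\Delta'$ be bounded and co-bounded $(m,n)$-invariant sets. If $\Delta$ and $\Delta'$ have the same associated monotone parking function, then $\Delta\sim\Delta'$.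 -/

import Mathlib

/-- `Δ` is a `k`-invariant set of integers: `Δ + k ⊆ Δ`. -/
def IsInvariantSet (k : ℕ) (Δ : Set ℤ) : Prop :=
  ∀ a ∈ Δ, a + (k : ℤ) ∈ Δ

/-- `Δ` is bounded: it has a minimum element. -/
def IsBoundedSet (Δ : Set ℤ) : Prop :=
  ∃ a, IsLeast Δ a

/-- `Δ` is co-bounded: it contains all sufficiently large integers. -/
def IsCoboundedSet (Δ : Set ℤ) : Prop :=
  ∃ k : ℤ, ∀ a, k ≤ a → a ∈ Δ

/-- A bounded and co-bounded `(m, n)`-invariant set. -/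
structure IsBCInvariantSet (m n : ℕ) (Δ : Set ℤ) : Prop where
  invariant_left : IsInvariantSet m Δ
  invariant_right : IsInvariantSet n Δ
  bounded : IsBoundedSet Δ
  cobounded : IsCoboundedSet Δ

/-- The `k`-generators of `Δ`: the elements `a` of `Δ` with `a - k` not in `Δ`. -/
def generatorSet (k : ℕ) (Δ : Set ℤ) : Set ℤ :=
  {a | a ∈ Δ ∧ a - (k : ℤ) ∉ Δ}

/-- The `k`-cogenerators of `Δ`: the integers `a` outside `Δ` with `a + k` in `Δ`. -/
def cogeneratorSet (k : ℕ) (Δ : Set ℤ) : Set ℤ :=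
  {a | a ∉ Δ ∧ a + (k : ℤ) ∈ Δ}

/-- The skeleton of an `(m, n)`-invariant set: its `m`-generators and its `n`-cogenerators. -/
def skeletonSet (m n : ℕ) (Δ : Set ℤ) : Set ℤ :=
  generatorSet m Δ ∪ cogeneratorSet n Δ

/-- `Δ` is `0`-balanced: as many nonnegative integers are missing from `Δ` as there are negative
integers in `Δ`. -/
def IsZeroBalanced (Δ : Set ℤ) : Prop :=
  {a : ℤ | 0 ≤ a ∧ a ∉ Δ}.encard = {a : ℤ | a < 0 ∧ a ∈ Δ}.encard

/-! ### Words acting on invariant sets -/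

/-- The letter `j` removes from `Δ` its `m`-generator `a_j`, where `a_0 < a_1 < ⋯` are the
`m`-generators of `Δ`; that is, the `m`-generator with exactly `j` smaller `m`-generators. -/
def letterAct (m : ℕ) (j : ℕ) (Δ : Set ℤ) : Set ℤ :=
  Δ \ {a | a ∈ generatorSet m Δ ∧ {b | b ∈ generatorSet m Δ ∧ b < a}.ncard = j}

/-- The word `w = w_{n-1} ⋯ w_1 w_0` acts from right to left:
`w · Δ = w_{n-1} (⋯ (w_1 (w_0 Δ)))`. -/
def wordAct {m n : ℕ} (w : Fin n → Fin m) (Δ : Set ℤ) : Set ℤ :=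
  (List.ofFn w).foldl (fun D j => letterAct m (j : ℕ) D) Δ

/-- `w` is an `(m, n)`-parking function: `#{j : w_j < i} ≥ i n / m` for `1 ≤ i ≤ m`. -/
def IsParkingWord {m n : ℕ} (w : Fin n → Fin m) : Prop :=
  ∀ i : ℕ, 1 ≤ i → i ≤ m →
    ((i : ℚ) * (n : ℚ)) / (m : ℚ) ≤ ({j : Fin n | (w j : ℕ) < i}.ncard : ℚ)

/-- `p` is the associated monotone parking function of `Δ`: it is an `(m, n)`-parking function,
`p_0 ≤ p_1 ≤ ⋯ ≤ p_{n-1}`, and `p · Δ = Δ + n`. -/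
structure IsAssociatedMonotoneParking {m n : ℕ} (Δ : Set ℤ) (p : Fin n → Fin m) : Prop where
  parking : IsParkingWord p
  monotone : Monotone p
  act_eq : wordAct p Δ = (fun a : ℤ => a + (n : ℤ)) '' Δ

/-! ### The equivalence relation of Gorsky, Mazin and Vazirani -/

/-- The set `d A + t` of real numbers, for a set `A` of integers and a real shift `t`. -/
def scaledShift (d : ℕ) (A : Set ℤ) (t : ℝ) : Set ℝ :=
  (fun a : ℤ => (d : ℝ) * (a : ℝ) + t) '' A

/-- `Δ(x_0, …, x_{d-1})`, the union of the sets `d Δ_i + x_i`. -/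
def shiftUnion {d : ℕ} (Θ : Fin d → Set ℤ) (x : Fin d → ℝ) : Set ℝ :=
  ⋃ i, scaledShift d (Θ i) (x i)

/-- `Θ` is a `d`-tuple of `0`-balanced (bounded and co-bounded) `(m', n')`-invariant sets. -/
def IsBalancedTuple (m' n' : ℕ) {d : ℕ} (Θ : Fin d → Set ℤ) : Prop :=
  ∀ i, IsBCInvariantSet m' n' (Θ i) ∧ IsZeroBalanced (Θ i)

/-- The space of shifts: the hyperplane of vectors in `ℝ^d` with coordinate sum zero. -/
def shiftSpace (d : ℕ) : Set (Fin d → ℝ) :=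
  {x | ∑ i, x i = 0}

/-- The arrangement `Σ_Θ`: the shifts for which two of the sets `d S_i + x_i` meet, where `S_i` is
the skeleton of the `(m', n')`-invariant set `Θ i`. -/
def shiftArrangement (m' n' : ℕ) {d : ℕ} (Θ : Fin d → Set ℤ) : Set (Fin d → ℝ) :=
  {x | x ∈ shiftSpace d ∧ ∃ i j, i ≠ j ∧
    (scaledShift d (skeletonSet m' n' (Θ i)) (x i) ∩
      scaledShift d (skeletonSet m' n' (Θ j)) (x j)).Nonempty}

/-- `x` and `y` lie in the same connected component of the complement of `Σ_Θ` in the space of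
shifts. -/
def SameRegion (m' n' : ℕ) {d : ℕ} (Θ : Fin d → Set ℤ) (x y : Fin d → ℝ) : Prop :=
  x ∈ shiftSpace d \ shiftArrangement m' n' Θ ∧
    y ∈ connectedComponentIn (shiftSpace d \ shiftArrangement m' n' Θ) x

/-- The set `Δ` of integers corresponds to the shift `x` of the tuple `Θ`: up to a translation,
`Δ` is `Δ(x_0, …, x_{d-1})`. (If `Δ` is co-bounded and the `Θ i` are nonempty, this forces the
translated shifts to be integers, one in each residue class modulo `d`.) -/
def CorrespondsToShift {d : ℕ} (Θ : Fin d → Set ℤ) (x : Fin d → ℝ) (Δ : Set ℤ) : Prop :=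
  ∃ c : ℝ, shiftUnion Θ x = (fun a : ℤ => (a : ℝ) + c) '' Δ

/-- Two `(m, n)`-invariant sets are equivalent if, with `d = gcd(m, n)`, they correspond (up to
translation) to shifts of one tuple `Θ` of `0`-balanced `(m / d, n / d)`-invariant sets that lie in
the same region of `Σ_Θ`. The order of the tuple is immaterial, since any `Θ` may be chosen. -/
def GMVEquivalent (m n : ℕ) (Δ Δ' : Set ℤ) : Prop :=
  ∃ (Θ : Fin (Nat.gcd m n) → Set ℤ) (x y : Fin (Nat.gcd m n) → ℝ),
    IsBalancedTuple (m / Nat.gcd m n) (n / Nat.gcd m n) Θ ∧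
    CorrespondsToShift Θ x Δ ∧ CorrespondsToShift Θ y Δ' ∧
    SameRegion (m / Nat.gcd m n) (n / Nat.gcd m n) Θ x y

/-!
The associated monotone parking function `p` of `Δ` determines how the skeleton of `Δ` interleaves.
A weakly increasing word removes `m`-generators in increasing order, so `p` removes the elements of
`Δ \ (Δ + n)`, which are the `n`-cogenerators shifted by `n`, from the smallest to the largest, and
its `k`-th letter is the number of `m`-generators below the `k`-th `n`-cogenerator
(`exists_skeleton_enumeration`). Hence, if `Δ` and `Δ'` share `p`, there is an order-preserving
bijection `s ↦ s'` between their skeletons that matches generators with generators and cogenerators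
with cogenerators.

The skeleton of `Δ` is permuted by the map that sends an `m`-generator `a` to `a - n` and an
`n`-cogenerator `c` to `c + m` (`exists_skeleton_perm`). Under the bijection the permutations of the
two skeletons agree (`perm_eq_of_apply_eq_add`): both move corresponding points by the same amount,
so the sum of the squares `(s - s')²` does not change when each permutation is applied to its own
skeleton, and the equality case of the rearrangement inequality leaves no room for two different
permutations. It follows that `s' - s` is invariant under the common permutation. A nonempty
invariant subset with `g` generators and `h` cogenerators satisfies `n * g = m * h`, so `g` is a
positive multiple of `m / d` with `d = gcd m n`; since a residue class modulo `d` contains only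
`m / d` generators, `s' - s` is constant on it (`skeleton_shift_eq`).

So `Δ'` arises from `Δ` by translating the parts in the residue classes modulo `d`, without changing
the order of the skeleton (`exists_residue_shift`). Rescaled and centred, these parts form one
balanced tuple for both sets, and along the segment between the two vectors of shifts the order of
the skeleton points stays the same; the segment never meets the arrangement, so its ends lie in the
same region (`gmvEquivalent_of_residue_shift`).
-/

/-! ### Generators -/

theorem IsInvariantSet.add_mul_mem {k : ℕ} {Δ : Set ℤ} (h : IsInvariantSet k Δ) {a : ℤ}
    (ha : a ∈ Δ) (t : ℕ) : a + k * t ∈ Δ := by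
  induction t with
  | zero => simpa using ha
  | succ t ih =>
    have := h _ ih
    push_cast
    rwa [mul_add, mul_one, ← add_assoc]

/-- Every element of a bounded set lies above a `k`-generator in its residue class: subtract `k`
until the set is left. -/
theorem exists_generator_add_mul {k : ℕ} (hk : 0 < k) {Δ : Set ℤ} (hb : IsBoundedSet Δ) {x : ℤ}
    (hx : x ∈ Δ) : ∃ g ∈ generatorSet k Δ, ∃ t : ℕ, x = g + k * t := by
  classical
  obtain ⟨b, hb⟩ := hb
  have hex : ∃ t : ℕ, x - k * t ∉ Δ := by
    refine ⟨(x - b).toNat + 1, fun h => ?_⟩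
    have h1 := hb.2 h
    have h2 := hb.2 hx
    have h3 : ((x - b).toNat : ℤ) = x - b := Int.toNat_of_nonneg (by linarith)
    push_cast at h1
    rw [h3] at h1
    have : (1 : ℤ) ≤ k := by exact_mod_cast hk
    nlinarith
  have hpos : Nat.find hex ≠ 0 := fun h0 => by
    have := Nat.find_spec hex
    rw [h0] at this
    exact this (by simpa using hx)
  obtain ⟨t, ht⟩ := Nat.exists_eq_succ_of_ne_zero hpos
  refine ⟨x - k * t, ⟨?_, ?_⟩, t, by ring⟩
  · exact not_not.1 (Nat.find_min hex (m := t) (by omega))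
  · have := Nat.find_spec hex
    rw [ht] at this
    rwa [show x - k * t - k = x - k * (t.succ : ℤ) by push_cast; ring]

theorem generatorSet_eq_of_modEq {k : ℕ} {Δ : Set ℤ} (h : IsInvariantSet k Δ) {a b : ℤ}
    (ha : a ∈ generatorSet k Δ) (hb : b ∈ generatorSet k Δ) (hab : (k : ℤ) ∣ b - a) : a = b := by
  have key : ∀ {a b : ℤ}, a ∈ generatorSet k Δ → b ∈ generatorSet k Δ → (k : ℤ) ∣ b - a →
      ¬ a < b := by
    rintro a b ha hb ⟨t, ht⟩ hlt
    have ht0 : 1 ≤ t := by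
      by_contra hcon
      have : (k : ℤ) * t ≤ 0 := mul_nonpos_of_nonneg_of_nonpos (by positivity) (by omega)
      omega
    have := h.add_mul_mem ha.1 (t - 1).toNat
    rw [Int.toNat_of_nonneg (by omega)] at this
    refine hb.2 ?_
    convert this using 1
    linarith
  rcases lt_trichotomy a b with hlt | heq | hlt
  · exact (key ha hb hab hlt).elim
  · exact heq
  · exact (key hb ha (by rw [← neg_sub]; exact (dvd_neg).2 hab) hlt).elim

/-- There is exactly one `k`-generator in every residue class modulo `k`. -/
theorem bijOn_generatorSet_emod {k : ℕ} (hk : 0 < k) {Δ : Set ℤ} (h : IsInvariantSet k Δ)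
    (hb : IsBoundedSet Δ) (hc : IsCoboundedSet Δ) :
    Set.BijOn (fun a : ℤ => a % k) (generatorSet k Δ) (Set.Ico 0 (k : ℤ)) := by
  have hk' : (0 : ℤ) < k := by exact_mod_cast hk
  refine ⟨fun a _ => ⟨Int.emod_nonneg _ hk'.ne', Int.emod_lt_of_pos _ hk'⟩, ?_, ?_⟩
  · intro a ha b hb hab
    exact generatorSet_eq_of_modEq h ha hb (Int.ModEq.dvd hab)
  · rintro r ⟨hr0, hrk⟩
    obtain ⟨K, hK⟩ := hc
    have hmem : r + k * |K| ∈ Δ := by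
      apply hK
      have := le_abs_self K
      have := abs_nonneg K
      nlinarith
    obtain ⟨g, hg, t, ht⟩ := exists_generator_add_mul hk hb hmem
    refine ⟨g, hg, ?_⟩
    have : g = r + k * (|K| - t) := by linarith
    simp only [this, Int.add_mul_emod_self_left]
    exact Int.emod_eq_of_lt hr0 hrk

theorem generatorSet_finite {k : ℕ} (hk : 0 < k) {Δ : Set ℤ} (h : IsInvariantSet k Δ)
    (hb : IsBoundedSet Δ) (hc : IsCoboundedSet Δ) : (generatorSet k Δ).Finite :=
  (bijOn_generatorSet_emod hk h hb hc).finite_iff_finite.2 (Set.finite_Ico _ _)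

theorem ncard_generatorSet {k : ℕ} (hk : 0 < k) {Δ : Set ℤ} (h : IsInvariantSet k Δ)
    (hb : IsBoundedSet Δ) (hc : IsCoboundedSet Δ) : (generatorSet k Δ).ncard = k := by
  have hB := bijOn_generatorSet_emod hk h hb hc
  rw [← hB.injOn.ncard_image, hB.image_eq, ← Finset.coe_Ico, Set.ncard_coe_finset]
  simp

/-! ### Words acting on invariant sets -/

/-- The `m`-generators below `t` depend only on the part of the set below `t`. -/
theorem generatorSet_lt_congr {m : ℕ} {D E : Set ℤ} {t : ℤ}
    (h : ∀ a < t, a ∈ D ↔ a ∈ E) :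
    {a | a ∈ generatorSet m D ∧ a < t} = {a | a ∈ generatorSet m E ∧ a < t} := by
  ext a
  simp only [generatorSet, Set.mem_ofPred_eq]
  constructor
  · rintro ⟨⟨h1, h2⟩, h3⟩
    exact ⟨⟨(h a h3).1 h1, fun h4 => h2 ((h _ (by omega)).2 h4)⟩, h3⟩
  · rintro ⟨⟨h1, h2⟩, h3⟩
    exact ⟨⟨(h a h3).2 h1, fun h4 => h2 ((h _ (by omega)).1 h4)⟩, h3⟩

theorem ncard_generatorSet_lt_lt {m : ℕ} {D : Set ℤ} (hfin : (generatorSet m D).Finite)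
    {s t : ℤ} (hs : s ∈ generatorSet m D) (hst : s < t) :
    {a | a ∈ generatorSet m D ∧ a < s}.ncard < {a | a ∈ generatorSet m D ∧ a < t}.ncard := by
  refine Set.ncard_lt_ncard ?_ (hfin.subset fun a ha => ha.1)
  have hsub : {a | a ∈ generatorSet m D ∧ a < s} ⊆ {a | a ∈ generatorSet m D ∧ a < t} :=
    fun a ha => ⟨ha.1, ha.2.trans hst⟩
  refine (Set.ssubset_iff_of_subset hsub).2 ⟨s, ⟨hs, hst⟩, ?_⟩
  simp

/-- A letter smaller than `m` removes exactly one `m`-generator. -/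
theorem exists_letterAct_eq {m j : ℕ} (hj : j < m) {D : Set ℤ} (h : IsInvariantSet m D)
    (hb : IsBoundedSet D) (hc : IsCoboundedSet D) :
    ∃ b ∈ generatorSet m D, {a | a ∈ generatorSet m D ∧ a < b}.ncard = j ∧
      letterAct m j D = D \ {b} := by
  have hm : 0 < m := by omega
  have hfin := generatorSet_finite hm h hb hc
  have hcard := ncard_generatorSet hm h hb hc
  have hcard' : hfin.toFinset.card = m := by rw [← Set.ncard_eq_toFinset_card _ hfin, hcard]
  set e := hfin.toFinset.orderEmbOfFin hcard'
  have hrange : ∀ a, a ∈ generatorSet m D ↔ ∃ i, e i = a := fun a => by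
    have := Finset.range_orderEmbOfFin hfin.toFinset hcard'
    rw [← Set.mem_range, this]
    simp
  have hbelow : ∀ i : Fin m, {a | a ∈ generatorSet m D ∧ a < e i}.ncard = i := fun i => by
    have : {a | a ∈ generatorSet m D ∧ a < e i} = e '' (Set.Iio i) := by
      ext a
      simp only [hrange, Set.mem_ofPred_eq, Set.mem_image, Set.mem_Iio]
      constructor
      · rintro ⟨⟨i', rfl⟩, h2⟩
        exact ⟨i', by simpa using h2, rfl⟩
      · rintro ⟨i', h2, rfl⟩
        exact ⟨⟨i', rfl⟩, by simpa using h2⟩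
    rw [this, Set.ncard_image_of_injective _ e.injective, ← Finset.coe_Iio, Set.ncard_coe_finset,
      Fin.card_Iio]
  have hmem : e ⟨j, hj⟩ ∈ generatorSet m D := (hrange _).2 ⟨_, rfl⟩
  refine ⟨e ⟨j, hj⟩, hmem, hbelow _, ?_⟩
  unfold letterAct
  congr 1
  ext a
  simp only [Set.mem_ofPred_eq, Set.mem_singleton_iff]
  constructor
  · rintro ⟨ha, hcardj⟩
    obtain ⟨i, rfl⟩ := (hrange a).1 ha
    rw [hbelow] at hcardj
    congr 1
    ext
    exact hcardj
  · rintro rfl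
    exact ⟨hmem, hbelow _⟩

theorem IsInvariantSet.diff_generator {m : ℕ} {D : Set ℤ} (h : IsInvariantSet m D) {b : ℤ}
    (hb : b ∈ generatorSet m D) : IsInvariantSet m (D \ {b}) := by
  rintro a ⟨ha, -⟩
  refine ⟨h a ha, ?_⟩
  rintro rfl
  exact hb.2 (by simpa using ha)

theorem IsCoboundedSet.diff_singleton {D : Set ℤ} (h : IsCoboundedSet D) (b : ℤ) :
    IsCoboundedSet (D \ {b}) := by
  obtain ⟨K, hK⟩ := h
  refine ⟨max K (b + 1), fun a ha => ⟨hK a (le_trans (le_max_left _ _) ha), ?_⟩⟩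
  have := le_trans (le_max_right _ _) ha
  simp only [Set.mem_singleton_iff]
  omega

theorem IsBoundedSet.mono {D E : Set ℤ} (h : IsBoundedSet D) (hED : E ⊆ D) (hne : E.Nonempty) :
    IsBoundedSet E := by
  obtain ⟨b, hb⟩ := h
  obtain ⟨a, ha, hmin⟩ := Int.exists_least_of_bdd (P := fun x => x ∈ E)
    ⟨b, fun z hz => hb.2 (hED hz)⟩ hne
  exact ⟨a, ha, hmin⟩

theorem IsCoboundedSet.nonempty {D : Set ℤ} (h : IsCoboundedSet D) : D.Nonempty := by
  obtain ⟨K, hK⟩ := h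
  exact ⟨K, hK K le_rfl⟩

/-- A weakly increasing word removes the elements `b_0 < b_1 < ⋯` of `D` in increasing order. Since
everything that will be removed below `b_k` is already gone when `b_k` is removed, the letter that
removes `b_k` counts the `m`-generators below `b_k` of the final set. -/
theorem exists_removed_list {m : ℕ} (l : List ℕ) (hl : l.Pairwise (· ≤ ·)) (hlm : ∀ j ∈ l, j < m)
    (D : Set ℤ) (h : IsInvariantSet m D) (hb : IsBoundedSet D) (hc : IsCoboundedSet D) :
    ∃ b : List ℤ, b.Pairwise (· < ·) ∧
      l.foldl (fun D j => letterAct m j D) D = D \ {x | x ∈ b} ∧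
      (∀ x ∈ b, x ∈ D ∧ x - (m : ℤ) ∉ l.foldl (fun D j => letterAct m j D) D) ∧
      List.Forall₂ (fun j x => {a | a ∈ generatorSet m (l.foldl (fun D j => letterAct m j D) D) ∧
        a < x}.ncard = j) l b := by
  induction l generalizing D with
  | nil => exact ⟨[], by simp⟩
  | cons j l ih =>
    obtain ⟨b₀, hb₀, hj, hact⟩ := exists_letterAct_eq (hlm j (by simp)) h hb hc
    have hc' := hc.diff_singleton b₀
    obtain ⟨b, hsort, hfold, hmem, hcount⟩ := ih (List.pairwise_cons.1 hl).2
      (fun i hi => hlm i (by simp [hi])) (D \ {b₀}) (h.diff_generator hb₀)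
      (hb.mono Set.sdiff_subset hc'.nonempty) hc'
    simp only [List.foldl_cons, hact]
    set E := l.foldl (fun D j => letterAct m j D) (D \ {b₀}) with hE
    have hfin := generatorSet_finite (Nat.lt_of_le_of_lt (Nat.zero_le _) (hlm j (by simp))) h hb hc
    -- Below a point under all removed elements, nothing has changed.
    have hagree : ∀ t : ℤ, t ≤ b₀ → (∀ x ∈ b, t ≤ x) → ∀ a < t, a ∈ E ↔ a ∈ D := by
      intro t ht hxb a hat
      rw [hfold]
      simp only [Set.mem_sdiff, Set.mem_singleton_iff, Set.mem_ofPred_eq]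
      constructor
      · exact fun h => h.1.1
      · refine fun h => ⟨⟨h, by omega⟩, fun hab => ?_⟩
        have := hxb a hab
        omega
    -- The next removed generator has at least as many generators below it, so it is larger.
    have hlt : ∀ x ∈ b, b₀ < x := by
      cases hcount with
      | nil => simp
      | @cons j' b₁ l' b' hj' hrest =>
        have hmin : ∀ x ∈ b₁ :: b', b₁ ≤ x := by
          intro x hx
          rcases List.mem_cons.1 hx with rfl | hx
          · exact le_rfl
          · exact ((List.pairwise_cons.1 hsort).1 x hx).le
        suffices b₀ < b₁ from fun x hx => lt_of_lt_of_le this (hmin x hx)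
        by_contra hle
        obtain ⟨⟨hb₁D, hne⟩, hb₁m⟩ := hmem b₁ (by simp)
        have hlt : b₁ < b₀ := lt_of_le_of_ne (not_lt.1 hle) hne
        have hag := hagree b₁ hlt.le hmin
        have hjj' : j ≤ j' := (List.pairwise_cons.1 hl).1 j' (by simp)
        have hm0 : 0 < m := Nat.lt_of_le_of_lt (Nat.zero_le _) (hlm j (by simp))
        have hgen : b₁ ∈ generatorSet m D :=
          ⟨hb₁D, fun hcon => hb₁m ((hag _ (by omega)).2 hcon)⟩
        rw [generatorSet_lt_congr hag] at hj'
        have := ncard_generatorSet_lt_lt hfin hgen hlt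
        omega
    refine ⟨b₀ :: b, List.pairwise_cons.2 ⟨hlt, hsort⟩, ?_, ?_, ?_⟩
    · rw [hfold]
      ext a
      simp only [Set.mem_sdiff, Set.mem_singleton_iff, Set.mem_ofPred_eq, List.mem_cons]
      tauto
    · intro x hx
      rcases List.mem_cons.1 hx with rfl | hx
      · refine ⟨hb₀.1, fun hcon => hb₀.2 ?_⟩
        rw [hfold] at hcon
        exact hcon.1.1
      · exact ⟨(hmem x hx).1.1, (hmem x hx).2⟩
    · refine List.Forall₂.cons ?_ hcount
      rw [generatorSet_lt_congr (hagree b₀ le_rfl fun x hx => (hlt x hx).le), hj]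

/-- The associated monotone parking function records how the `m`-generators `a_0 < a_1 < ⋯` and
the `n`-cogenerators `c_0 < c_1 < ⋯` interleave: its letter `p_k` is the number of `m`-generators
below `c_k`. -/
theorem exists_skeleton_enumeration {m n : ℕ} (hm : 0 < m) {Δ : Set ℤ}
    (hΔ : IsBCInvariantSet m n Δ) {p : Fin n → Fin m} (hp : IsAssociatedMonotoneParking Δ p) :
    ∃ (a : Fin m → ℤ) (c : Fin n → ℤ), StrictMono a ∧ StrictMono c ∧
      Set.range a = generatorSet m Δ ∧ Set.range c = cogeneratorSet n Δ ∧
      ∀ i k, a i < c k ↔ i < p k := by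
  have hfin := generatorSet_finite hm hΔ.invariant_left hΔ.bounded hΔ.cobounded
  have hcard := ncard_generatorSet hm hΔ.invariant_left hΔ.bounded hΔ.cobounded
  have hcard' : hfin.toFinset.card = m := by rw [← Set.ncard_eq_toFinset_card _ hfin, hcard]
  set a := hfin.toFinset.orderEmbOfFin hcard'
  have hrange : Set.range a = generatorSet m Δ := by
    have := Finset.range_orderEmbOfFin hfin.toFinset hcard'
    rw [this]
    simp
  obtain ⟨b, hsort, hfold, hmem, hcount⟩ := exists_removed_list
    (m := m) (List.ofFn fun k => (p k : ℕ))
    (List.pairwise_ofFn.2 fun i j hij => hp.monotone hij.le)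
    (by simp [List.mem_ofFn]) Δ hΔ.invariant_left hΔ.bounded hΔ.cobounded
  have hact : (List.ofFn fun k => (p k : ℕ)).foldl (fun D j => letterAct m j D) Δ =
      (fun x : ℤ => x + (n : ℤ)) '' Δ := by
    -- `wordAct` coerces the word to a list of naturals by a monadic bind, which is a `List.map`.
    rw [← hp.act_eq, wordAct]
    congr 1
    simp only [List.pure_def, List.bind_eq_flatMap, List.map_ofFn,
      ← List.map_eq_flatMap]
    rfl
  rw [hact] at hfold hcount
  have hmemE : ∀ x : ℤ, x ∈ (fun x : ℤ => x + (n : ℤ)) '' Δ ↔ x - n ∈ Δ := fun x =>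
    ⟨by rintro ⟨y, hy, rfl⟩; simpa using hy, fun h => ⟨_, h, by simp⟩⟩
  have hlen : b.length = n := by rw [← hcount.length_eq, List.length_ofFn]
  have hremoved : ∀ x, x ∈ b ↔ x ∈ Δ ∧ x - n ∉ Δ := by
    intro x
    have := Set.ext_iff.1 hfold x
    rw [hmemE, Set.mem_sdiff, Set.mem_ofPred_eq] at this
    constructor
    · exact fun hx => ⟨(hmem x hx).1, fun hcon => (this.1 hcon).2 hx⟩
    · rintro ⟨h1, h2⟩
      by_contra hx
      exact h2 (this.2 ⟨h1, hx⟩)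
  have hgenE : ∀ x : ℤ, x ∈ generatorSet m ((fun x : ℤ => x + (n : ℤ)) '' Δ) ↔
      x - n ∈ generatorSet m Δ := fun x => by
    simp only [generatorSet, Set.mem_ofPred_eq, hmemE, sub_right_comm]
  refine ⟨a, fun k => b.get (k.cast hlen.symm) - n, a.strictMono, ?_, hrange, ?_, ?_⟩
  · intro k k' hkk'
    have := List.pairwise_iff_get.1 hsort (k.cast hlen.symm) (k'.cast hlen.symm) hkk'
    simp only
    omega
  · ext x
    simp only [Set.mem_range, cogeneratorSet, Set.mem_ofPred_eq]
    have hx := hremoved (x + n)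
    rw [add_sub_cancel_right] at hx
    rw [and_comm, ← hx, List.mem_iff_get]
    constructor
    · rintro ⟨k, hk⟩
      exact ⟨k.cast hlen.symm, by omega⟩
    · rintro ⟨k, hk⟩
      have hk' : b[(k : ℕ)] = x + n := hk
      exact ⟨k.cast hlen, by simp [hk']⟩
  · intro i k
    have hk := (List.forall₂_iff_get.1 hcount).2 k (by simp) (by rw [hlen]; exact k.2)
    simp only [List.get_ofFn, Fin.cast_mk] at hk
    set t : ℤ := b.get (k.cast hlen.symm) with ht
    have hcnt : {i : Fin m | a i < t - n}.ncard = p k := by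
      refine Eq.trans ?_ hk
      rw [← Set.ncard_image_of_injective _ (f := fun i => a i + n)
        (fun i j hij => a.injective (by simpa using hij))]
      congr 1
      ext x
      simp only [Set.mem_image, Set.mem_ofPred_eq, hgenE, ← hrange, Set.mem_range]
      constructor
      · rintro ⟨i, hi, rfl⟩
        exact ⟨⟨i, by simp⟩, by have : t = b.get ⟨k, by rw [hlen]; exact k.2⟩ := rfl
                                omega⟩
      · rintro ⟨⟨i, hi⟩, hx⟩
        refine ⟨i, ?_, by omega⟩
        have : t = b.get ⟨k, by rw [hlen]; exact k.2⟩ := rfl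
        omega
    rw [Fin.lt_def, ← hcnt]
    constructor
    · intro hi
      have hsub : ((Finset.Iic i : Finset (Fin m)) : Set (Fin m)) ⊆ {i : Fin m | a i < t - n} := by
        intro i' hi'
        have hle : i' ≤ i := by simpa using hi'
        exact lt_of_le_of_lt (a.monotone hle) hi
      have := Set.ncard_le_ncard hsub (Set.toFinite _)
      rw [Set.ncard_coe_finset, Fin.card_Iic] at this
      omega
    · intro hi
      by_contra hcon
      have hsub : {i : Fin m | a i < t - n} ⊆ ((Finset.Iio i : Finset (Fin m)) : Set (Fin m)) := by
        intro i' hi'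
        have hlt : a i' < a i := lt_of_lt_of_le hi' (not_lt.1 hcon)
        simpa using hlt
      have := Set.ncard_le_ncard hsub (Set.toFinite _)
      rw [Set.ncard_coe_finset, Fin.card_Iio] at this
      omega

/-! ### Residue classes -/

/-- The part of `Δ` in the residue class of `r` modulo `d`, rescaled to a set of integers. -/
def residuePart (d : ℕ) (r : ℤ) (Δ : Set ℤ) : Set ℤ :=
  {z | (d : ℤ) * z + r ∈ Δ}

theorem mem_residuePart {d : ℕ} {r : ℤ} {Δ : Set ℤ} {z : ℤ} :
    z ∈ residuePart d r Δ ↔ (d : ℤ) * z + r ∈ Δ :=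
  Iff.rfl

theorem mem_generatorSet_residuePart {d k : ℕ} {r : ℤ} {Δ : Set ℤ} {z : ℤ} :
    z ∈ generatorSet k (residuePart d r Δ) ↔ (d : ℤ) * z + r ∈ generatorSet (d * k) Δ := by
  simp only [generatorSet, Set.mem_ofPred_eq, mem_residuePart, Nat.cast_mul]
  rw [show (d : ℤ) * (z - k) + r = d * z + r - d * k by ring]

theorem mem_cogeneratorSet_residuePart {d k : ℕ} {r : ℤ} {Δ : Set ℤ} {z : ℤ} :
    z ∈ cogeneratorSet k (residuePart d r Δ) ↔ (d : ℤ) * z + r ∈ cogeneratorSet (d * k) Δ := by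
  simp only [cogeneratorSet, Set.mem_ofPred_eq, mem_residuePart, Nat.cast_mul]
  rw [show (d : ℤ) * (z + k) + r = d * z + r + d * k by ring]

theorem mem_skeletonSet_residuePart {d m n : ℕ} {r : ℤ} {Δ : Set ℤ} {z : ℤ} :
    z ∈ skeletonSet m n (residuePart d r Δ) ↔
      (d : ℤ) * z + r ∈ skeletonSet (d * m) (d * n) Δ := by
  simp only [skeletonSet, Set.mem_union, mem_generatorSet_residuePart,
    mem_cogeneratorSet_residuePart]

theorem IsInvariantSet.residuePart {d k : ℕ} {Δ : Set ℤ} (h : IsInvariantSet (d * k) Δ) (r : ℤ) :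
    IsInvariantSet k (residuePart d r Δ) := by
  intro z hz
  have := h _ hz
  rw [mem_residuePart]
  convert this using 1
  push_cast
  ring

theorem IsCoboundedSet.residuePart {d : ℕ} (hd : 0 < d) {Δ : Set ℤ} (h : IsCoboundedSet Δ)
    (r : ℤ) : IsCoboundedSet (residuePart d r Δ) := by
  obtain ⟨K, hK⟩ := h
  refine ⟨|K - r|, fun z hz => hK _ ?_⟩
  have h1 : (1 : ℤ) ≤ d := by exact_mod_cast hd
  have h2 := le_abs_self (K - r)
  have h3 := abs_nonneg (K - r)
  nlinarith

theorem IsBoundedSet.residuePart {d : ℕ} (hd : 0 < d) {Δ : Set ℤ} (h : IsBoundedSet Δ)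
    (hc : IsCoboundedSet Δ) (r : ℤ) : IsBoundedSet (residuePart d r Δ) := by
  obtain ⟨b, hb⟩ := h
  obtain ⟨a, ha, hmin⟩ := Int.exists_least_of_bdd (P := fun x => x ∈ _root_.residuePart d r Δ)
    ⟨-|b - r|, fun z hz => by
      have h1 : (1 : ℤ) ≤ d := by exact_mod_cast hd
      have h2 := neg_abs_le (b - r)
      have h3 := abs_nonneg (b - r)
      have h4 := hb.2 hz
      by_contra hcon
      nlinarith⟩ (hc.residuePart hd r).nonempty
  exact ⟨a, ha, hmin⟩

theorem IsBCInvariantSet.residuePart {d m n : ℕ} (hd : 0 < d) {Δ : Set ℤ}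
    (h : IsBCInvariantSet (d * m) (d * n) Δ) (r : ℤ) :
    IsBCInvariantSet m n (residuePart d r Δ) where
  invariant_left := h.invariant_left.residuePart r
  invariant_right := h.invariant_right.residuePart r
  bounded := h.bounded.residuePart hd h.cobounded r
  cobounded := h.cobounded.residuePart hd r

/-- A residue class modulo a divisor `d` of `d * k` contains `k` of the `d * k`-generators. -/
theorem ncard_generatorSet_emod_eq {d k : ℕ} (hd : 0 < d) (hk : 0 < k) {Δ : Set ℤ}
    (h : IsInvariantSet (d * k) Δ) (hb : IsBoundedSet Δ) (hc : IsCoboundedSet Δ) (r : ℤ) :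
    {x | x ∈ generatorSet (d * k) Δ ∧ x % d = r % d}.ncard = k := by
  refine Eq.trans ?_
    (ncard_generatorSet hk (h.residuePart r) (hb.residuePart hd hc r) (hc.residuePart hd r))
  rw [← Set.ncard_image_of_injective (generatorSet k (residuePart d r Δ))
      (f := fun z : ℤ => (d : ℤ) * z + r) (fun z w hzw => by
        simpa [hd.ne'] using hzw)]
  congr 1
  ext x
  simp only [Set.mem_image, Set.mem_ofPred_eq, mem_generatorSet_residuePart]
  constructor
  · rintro ⟨hx, hxr⟩
    obtain ⟨z, hz⟩ := Int.ModEq.dvd (show r ≡ x [ZMOD d] from hxr.symm)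
    have : (d : ℤ) * z + r = x := by linarith
    exact ⟨z, this ▸ hx, this⟩
  · rintro ⟨z, hz, rfl⟩
    exact ⟨hz, by simp⟩

/-! ### The permutation of the skeleton -/

/-- Walking along the boundary of the staircase of `Δ` permutes the skeleton: an `m`-generator `a`
goes to `a - n` and an `n`-cogenerator `c` goes to `c + m`. -/
theorem exists_skeleton_perm {m n : ℕ} {Δ : Set ℤ} (hm : IsInvariantSet m Δ)
    (hn : IsInvariantSet n Δ) {a : Fin m → ℤ} {c : Fin n → ℤ}
    (ha : Function.Injective a) (hc : Function.Injective c)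
    (har : Set.range a = generatorSet m Δ) (hcr : Set.range c = cogeneratorSet n Δ) :
    ∃ σ : Equiv.Perm (Fin m ⊕ Fin n), ∀ i,
      Sum.elim a c (σ i) = Sum.elim a c i + Sum.elim (fun _ => -(n : ℤ)) (fun _ => (m : ℤ)) i := by
  have hag : ∀ i, a i ∈ generatorSet m Δ := fun i => har ▸ Set.mem_range_self i
  have hcg : ∀ i, c i ∈ cogeneratorSet n Δ := fun i => hcr ▸ Set.mem_range_self i
  have hrange : ∀ x, x ∈ generatorSet m Δ ∨ x ∈ cogeneratorSet n Δ → ∃ j, Sum.elim a c j = x := by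
    rintro x (hx | hx)
    · obtain ⟨i, rfl⟩ := har.symm ▸ hx
      exact ⟨Sum.inl i, rfl⟩
    · obtain ⟨i, rfl⟩ := hcr.symm ▸ hx
      exact ⟨Sum.inr i, rfl⟩
  have hstep : ∀ i, ∃ j, Sum.elim a c j =
      Sum.elim a c i + Sum.elim (fun _ => -(n : ℤ)) (fun _ => (m : ℤ)) i := by
    rintro (i | k)
    · apply hrange
      simp only [Sum.elim_inl]
      by_cases h : a i + -(n : ℤ) ∈ Δ
      · refine Or.inl ⟨h, fun hcon => (hag i).2 ?_⟩
        convert hn _ hcon using 1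
        ring
      · exact Or.inr ⟨h, by simpa using (hag i).1⟩
    · apply hrange
      simp only [Sum.elim_inr]
      by_cases h : c k + (m : ℤ) ∈ Δ
      · exact Or.inl ⟨h, by simpa using (hcg k).1⟩
      · refine Or.inr ⟨h, ?_⟩
        convert hm _ (hcg k).2 using 1
        ring
  choose f hf using hstep
  -- If `a - n = c + m` then `a - m = c + n` would lie in `Δ`.
  have hne : ∀ i k, a i + -(n : ℤ) ≠ c k + m := fun i k hik => (hag i).2 <| by
    convert (hcg k).2 using 1
    linarith
  have hinj : Function.Injective f := by
    intro i j hij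
    have h : Sum.elim a c i + Sum.elim (fun _ => -(n : ℤ)) (fun _ => (m : ℤ)) i =
        Sum.elim a c j + Sum.elim (fun _ => -(n : ℤ)) (fun _ => (m : ℤ)) j := by
      rw [← hf, ← hf, hij]
    rcases i with i | i <;> rcases j with j | j <;> simp only [Sum.elim_inl, Sum.elim_inr] at h
    · exact congrArg _ (ha (by linarith))
    · exact (hne _ _ h).elim
    · exact (hne _ _ h.symm).elim
    · exact congrArg _ (hc (by linarith))
  exact ⟨Equiv.ofBijective f (Finite.injective_iff_bijective.1 hinj), hf⟩

/-- A finite family of integers and an equally ordered second one: if adding the same increments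
`δ` to both families permutes each of them, the two permutations agree. This is the equality case
of the rearrangement inequality, as `s - s'` is unchanged by the increments. -/
theorem perm_eq_of_apply_eq_add {ι : Type*} [Fintype ι] {s s' δ : ι → ℤ}
    (hs : Function.Injective s) (hord : ∀ i j, s i < s j ↔ s' i < s' j) {σ σ' : Equiv.Perm ι}
    (h : ∀ i, s (σ i) = s i + δ i) (h' : ∀ i, s' (σ' i) = s' i + δ i) : σ = σ' := by
  set τ : Equiv.Perm ι := σ * σ'⁻¹ with hτ
  have hmono : Monovary s s' := fun i j hij => ((hord i j).2 hij).le
  have hmono' : Monovary s s := fun i j hij => hij.le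
  have hsum : ∑ i, s (τ i) * s' i = ∑ i, s i * s' i := by
    have h1 : ∑ i, s (τ i) * s' i = ∑ i, s (σ i) * s' (σ' i) := by
      rw [← Equiv.sum_comp σ' (fun i => s (τ i) * s' i)]
      simp [hτ]
    have h2 : ∑ i, s (σ i) ^ 2 = ∑ i, s i ^ 2 := Equiv.sum_comp σ (fun i => s i ^ 2)
    have h3 : ∑ i, s' (σ' i) ^ 2 = ∑ i, s' i ^ 2 := Equiv.sum_comp σ' (fun i => s' i ^ 2)
    have h4 : ∑ i, (s (σ i) ^ 2 + s' (σ' i) ^ 2 - 2 * (s (σ i) * s' (σ' i))) =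
        ∑ i, (s i ^ 2 + s' i ^ 2 - 2 * (s i * s' i)) := by
      refine Finset.sum_congr rfl fun i _ => ?_
      rw [h, h']
      ring
    simp only [Finset.sum_sub_distrib, Finset.sum_add_distrib, ← Finset.mul_sum] at h4
    linarith
  have hτs : ∑ i, s (τ i) * s i = ∑ i, s i * s i :=
    hmono'.sum_comp_perm_mul_eq_sum_mul_iff.2 fun i j hij =>
      hmono.sum_comp_perm_mul_eq_sum_mul_iff.1 hsum ((hord i j).1 hij)
  have hsq : ∑ i, (s (τ i) - s i) ^ 2 = 0 := by
    have h2 : ∑ i, s (τ i) ^ 2 = ∑ i, s i ^ 2 := Equiv.sum_comp τ (fun i => s i ^ 2)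
    have h3 : ∀ i, (s (τ i) - s i) ^ 2 = s (τ i) ^ 2 + s i ^ 2 - 2 * (s (τ i) * s i) :=
      fun i => by ring
    simp only [h3, Finset.sum_sub_distrib, Finset.sum_add_distrib, ← Finset.mul_sum, hτs, h2]
    simp only [pow_two]
    ring
  have hτ1 : τ = 1 := by
    ext i
    have := (Finset.sum_eq_zero_iff_of_nonneg fun i _ => sq_nonneg _).1 hsq i (Finset.mem_univ i)
    exact hs (sub_eq_zero.1 (pow_eq_zero_iff two_ne_zero |>.1 this))
  exact mul_inv_eq_one.1 hτ1

/-- The steps `-n` and `m` along a subset of the skeleton that the permutation maps into itself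
add up to zero. -/
theorem mul_card_toLeft_eq {m n : ℕ} {s : Fin m ⊕ Fin n → ℤ} {σ : Equiv.Perm (Fin m ⊕ Fin n)}
    (hσ : ∀ i, s (σ i) = s i + Sum.elim (fun _ => -(n : ℤ)) (fun _ => (m : ℤ)) i)
    (U : Finset (Fin m ⊕ Fin n)) (hU : ∀ i ∈ U, σ i ∈ U) :
    n * U.toLeft.card = m * U.toRight.card := by
  have hmap : U.map σ.toEmbedding = U := by
    refine Finset.eq_of_subset_of_card_le (fun x hx => ?_) (by simp)
    obtain ⟨i, hi, rfl⟩ := Finset.mem_map.1 hx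
    exact hU i hi
  have h1 : ∑ i ∈ U, s (σ i) = ∑ i ∈ U, s i := by
    conv_rhs => rw [← hmap, Finset.sum_map]
    rfl
  simp only [hσ, Finset.sum_add_distrib] at h1
  have h2 : ∑ i ∈ U, Sum.elim (fun _ => -(n : ℤ)) (fun _ => (m : ℤ)) i = 0 := by linarith
  rw [← Finset.toLeft_disjSum_toRight (u := U), Finset.sum_disjSum] at h2
  simp only [Sum.elim_inl, Sum.elim_inr, Finset.sum_const, nsmul_eq_mul] at h2
  zify
  linarith

/-- Two skeletons that interleave in the same way differ by a shift that is constant on each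
residue class modulo `gcd m n`: a subset of a residue class on which the shift is constant is
mapped into itself by the common permutation, so it contains a multiple of `m / gcd m n`
generators, which is all of them. -/
theorem skeleton_shift_eq {m n : ℕ} (hm : 0 < m) (hn : 0 < n) {Δ : Set ℤ}
    (hΔ : IsBCInvariantSet m n Δ) {a : Fin m → ℤ} {c : Fin n → ℤ}
    (ha : Function.Injective a) (har : Set.range a = generatorSet m Δ)
    {s' : Fin m ⊕ Fin n → ℤ} {σ : Equiv.Perm (Fin m ⊕ Fin n)}
    (hσ : ∀ i, Sum.elim a c (σ i) =
      Sum.elim a c i + Sum.elim (fun _ => -(n : ℤ)) (fun _ => (m : ℤ)) i)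
    (hσ' : ∀ i, s' (σ i) = s' i + Sum.elim (fun _ => -(n : ℤ)) (fun _ => (m : ℤ)) i)
    {i j : Fin m ⊕ Fin n}
    (hij : Sum.elim a c i % (Nat.gcd m n : ℤ) = Sum.elim a c j % (Nat.gcd m n : ℤ)) :
    s' i - Sum.elim a c i = s' j - Sum.elim a c j := by
  classical
  set d := Nat.gcd m n with hd
  have hd0 : 0 < d := Nat.gcd_pos_of_pos_left n hm
  obtain ⟨m', hm'⟩ : d ∣ m := Nat.gcd_dvd_left m n
  obtain ⟨n', hn'⟩ : d ∣ n := Nat.gcd_dvd_right m n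
  have hcop : Nat.Coprime m' n' := by
    have := Nat.gcd_mul_left d m' n'
    rw [← hm', ← hn', ← hd] at this
    exact Nat.eq_of_mul_eq_mul_left hd0 (by rw [mul_one]; exact this.symm)
  have hm0 : 0 < m' := Nat.pos_of_ne_zero fun h => by simp [h] at hm'; omega
  have hn0 : 0 < n' := Nat.pos_of_ne_zero fun h => by simp [h] at hn'; omega
  set s := Sum.elim a c with hs
  set r := s i with hr
  set G : Finset (Fin m) := Finset.univ.filter fun k => a k % (d : ℤ) = r % d with hG
  have hGcard : G.card = m' := by
    have hΔm : IsInvariantSet (d * m') Δ := hm' ▸ hΔ.invariant_left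
    rw [← ncard_generatorSet_emod_eq hd0 hm0 hΔm hΔ.bounded hΔ.cobounded r, ← hm',
      ← Set.ncard_coe_finset, ← Set.ncard_image_of_injective _ ha]
    congr 1
    ext x
    simp only [hG, Finset.coe_filter, Finset.mem_univ, true_and, Set.mem_image, Set.mem_ofPred_eq,
      ← har, Set.mem_range]
    constructor
    · rintro ⟨k, hk, rfl⟩
      exact ⟨⟨k, rfl⟩, hk⟩
    · rintro ⟨⟨k, rfl⟩, hk⟩
      exact ⟨k, hk, rfl⟩
  have hδ : ∀ k : Fin m ⊕ Fin n,
      (d : ℤ) ∣ Sum.elim (fun _ => -(n : ℤ)) (fun _ => (m : ℤ)) k := by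
    rintro (k | k)
    · simpa using Int.natCast_dvd_natCast.2 (Nat.gcd_dvd_right m n)
    · simpa using Int.natCast_dvd_natCast.2 (Nat.gcd_dvd_left m n)
  -- The generators of a class that have the shift of a given element of the class are all of them.
  have key : ∀ e : Fin m ⊕ Fin n, s e % (d : ℤ) = r % d →
      ∀ k ∈ G, s' (Sum.inl k) - a k = s' e - s e := by
    intro e he
    set U : Finset (Fin m ⊕ Fin n) :=
      Finset.univ.filter fun k => s k % (d : ℤ) = r % d ∧ s' k - s k = s' e - s e with hUdef
    have hU : ∀ k ∈ U, σ k ∈ U := by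
      intro k hk
      simp only [hUdef, Finset.mem_filter, Finset.mem_univ, true_and] at hk ⊢
      obtain ⟨q, hq⟩ := hδ k
      refine ⟨?_, ?_⟩
      · rw [hσ, hq, Int.add_mul_emod_self_left]
        exact hk.1
      · rw [hσ, hσ', ← hk.2]
        ring
    have heU : e ∈ U := by simp [hUdef, he]
    have hcount := mul_card_toLeft_eq hσ U hU
    have hcount' : n' * U.toLeft.card = m' * U.toRight.card := by
      refine Nat.eq_of_mul_eq_mul_left hd0 ?_
      rw [← mul_assoc, ← mul_assoc, ← hm', ← hn', hcount]
    have hdvd : m' ∣ U.toLeft.card :=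
      hcop.dvd_of_dvd_mul_left ⟨_, hcount'⟩
    have hpos : 0 < U.toLeft.card := by
      by_contra hcon
      have h0 : U.toLeft.card = 0 := by omega
      rw [h0, mul_zero] at hcount'
      have h1 : U.toRight.card = 0 := by
        rcases Nat.mul_eq_zero.1 hcount'.symm with h | h
        · omega
        · exact h
      have h2 : U.card ≠ 0 := (Finset.card_pos.2 ⟨e, heU⟩).ne'
      have h3 := Finset.card_toLeft_add_card_toRight (u := U)
      omega
    have hsub : U.toLeft ⊆ G := by
      intro k hk
      rw [Finset.mem_toLeft] at hk
      simp only [hUdef, Finset.mem_filter, Finset.mem_univ, true_and] at hk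
      simpa [hG, hs] using hk.1
    have hall : U.toLeft = G :=
      Finset.eq_of_subset_of_card_le hsub (hGcard ▸ Nat.le_of_dvd hpos hdvd)
    intro k hk
    rw [← hall, Finset.mem_toLeft] at hk
    simp only [hUdef, Finset.mem_filter, Finset.mem_univ, true_and] at hk
    exact hk.2
  obtain ⟨k, hk⟩ : G.Nonempty := Finset.card_pos.1 (by omega)
  rw [← key i rfl k hk, ← key j hij.symm k hk]

/-- Two sets with the same associated monotone parking function differ by translations of their
parts in the residue classes modulo `gcd m n`, and these translations preserve the order of the
skeleton. -/
theorem exists_residue_shift {m n : ℕ} (hm : 0 < m) (hn : 0 < n) {Δ Δ' : Set ℤ}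
    (hΔ : IsBCInvariantSet m n Δ) (hΔ' : IsBCInvariantSet m n Δ') {p : Fin n → Fin m}
    (hp : IsAssociatedMonotoneParking Δ p) (hp' : IsAssociatedMonotoneParking Δ' p) :
    ∃ v : ℤ → ℤ, (∀ x, x ∈ Δ' ↔ ∃ y ∈ Δ, x = y + v (y % (Nat.gcd m n : ℤ))) ∧
      ∀ s ∈ skeletonSet m n Δ, ∀ t ∈ skeletonSet m n Δ, s < t →
        s + v (s % (Nat.gcd m n : ℤ)) < t + v (t % (Nat.gcd m n : ℤ)) := by
  obtain ⟨a, c, ha, hc, har, hcr, hac⟩ := exists_skeleton_enumeration hm hΔ hp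
  obtain ⟨a', c', ha', hc', har', hcr', hac'⟩ := exists_skeleton_enumeration hm hΔ' hp'
  obtain ⟨σ, hσ⟩ := exists_skeleton_perm hΔ.invariant_left hΔ.invariant_right ha.injective
    hc.injective har hcr
  obtain ⟨σ', hσ'⟩ := exists_skeleton_perm hΔ'.invariant_left hΔ'.invariant_right ha'.injective
    hc'.injective har' hcr'
  have hne : ∀ i k, a i ≠ c k := fun i k h => by
    have h1 : a i ∈ generatorSet m Δ := har ▸ Set.mem_range_self i
    have h2 : c k ∈ cogeneratorSet n Δ := hcr ▸ Set.mem_range_self k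
    exact h2.1 (h ▸ h1.1)
  have hne' : ∀ i k, a' i ≠ c' k := fun i k h => by
    have h1 : a' i ∈ generatorSet m Δ' := har' ▸ Set.mem_range_self i
    have h2 : c' k ∈ cogeneratorSet n Δ' := hcr' ▸ Set.mem_range_self k
    exact h2.1 (h ▸ h1.1)
  have hca : ∀ i k, c k < a i ↔ p k ≤ i := fun i k => by
    rw [← not_lt, ← hac i k, not_lt]
    exact ⟨le_of_lt, fun h => lt_of_le_of_ne h (hne i k).symm⟩
  have hca' : ∀ i k, c' k < a' i ↔ p k ≤ i := fun i k => by
    rw [← not_lt, ← hac' i k, not_lt]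
    exact ⟨le_of_lt, fun h => lt_of_le_of_ne h (hne' i k).symm⟩
  have hord : ∀ i j, Sum.elim a c i < Sum.elim a c j ↔ Sum.elim a' c' i < Sum.elim a' c' j := by
    rintro (i | i) (j | j) <;>
      simp only [Sum.elim_inl, Sum.elim_inr, ha.lt_iff_lt, ha'.lt_iff_lt, hc.lt_iff_lt,
        hc'.lt_iff_lt, hac, hac', hca, hca']
  have hinj : Function.Injective (Sum.elim a c) :=
    ha.injective.sumElim hc.injective hne
  obtain rfl := perm_eq_of_apply_eq_add hinj hord hσ hσ'
  set d : ℤ := (Nat.gcd m n : ℤ) with hd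
  set V : Fin m ⊕ Fin n → ℤ := fun i => Sum.elim a' c' i - Sum.elim a c i with hV
  have hfac : Function.FactorsThrough V fun i => Sum.elim a c i % d := fun i j hij =>
    skeleton_shift_eq hm hn hΔ ha.injective har hσ hσ' hij
  set v : ℤ → ℤ := Function.extend (fun i => Sum.elim a c i % d) V 0 with hv
  have hvs : ∀ i, Sum.elim a c i + v (Sum.elim a c i % d) = Sum.elim a' c' i := fun i => by
    rw [hv, hfac.extend_apply 0 i]
    simp [hV]
  have hdm : d ∣ (m : ℤ) := Int.natCast_dvd_natCast.2 (Nat.gcd_dvd_left m n)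
  have hmod : ∀ (g : ℤ) (t : ℕ), (g + m * t) % d = g % d := fun g t => by
    obtain ⟨q, hq⟩ := hdm
    rw [hq, mul_assoc, Int.add_mul_emod_self_left]
  refine ⟨v, fun x => ⟨fun hx => ?_, ?_⟩, ?_⟩
  · obtain ⟨g, hg, t, rfl⟩ := exists_generator_add_mul hm hΔ'.bounded hx
    rw [← har'] at hg
    obtain ⟨i, rfl⟩ := hg
    have h1 : a i ∈ generatorSet m Δ := har ▸ Set.mem_range_self i
    refine ⟨a i + m * t, hΔ.invariant_left.add_mul_mem h1.1 t, ?_⟩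
    have := hvs (Sum.inl i)
    simp only [Sum.elim_inl] at this
    rw [hmod, ← this]
    ring
  · rintro ⟨y, hy, rfl⟩
    obtain ⟨g, hg, t, rfl⟩ := exists_generator_add_mul hm hΔ.bounded hy
    rw [← har] at hg
    obtain ⟨i, rfl⟩ := hg
    have h1 : a' i ∈ generatorSet m Δ' := har' ▸ Set.mem_range_self i
    have := hvs (Sum.inl i)
    simp only [Sum.elim_inl] at this
    rw [hmod, add_right_comm, this]
    exact hΔ'.invariant_left.add_mul_mem h1.1 t
  · have hskel : ∀ s ∈ skeletonSet m n Δ, ∃ i, Sum.elim a c i = s := by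
      rintro s (hs | hs)
      · rw [← har] at hs
        obtain ⟨i, rfl⟩ := hs
        exact ⟨Sum.inl i, rfl⟩
      · rw [← hcr] at hs
        obtain ⟨i, rfl⟩ := hs
        exact ⟨Sum.inr i, rfl⟩
    intro s hs t ht hst
    obtain ⟨i, rfl⟩ := hskel s hs
    obtain ⟨j, rfl⟩ := hskel t ht
    rw [hvs, hvs]
    exact (hord i j).1 hst

/-! ### Shifts of balanced sets -/

/-- A bounded and co-bounded set has a `0`-balanced translate: if `Δ` agrees with the empty set
below `L` and with `ℤ` from `K` on, then `K - #(Δ ∩ [L, K))` is the origin to choose. -/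
theorem exists_isZeroBalanced_translate {Δ : Set ℤ} (hb : IsBoundedSet Δ) (hc : IsCoboundedSet Δ) :
    ∃ k : ℤ, IsZeroBalanced {z | z + k ∈ Δ} := by
  classical
  obtain ⟨L, hL, hmin⟩ := hb
  obtain ⟨K, hK⟩ := hc
  have hLK : ∀ z ∈ Δ, L ≤ z := fun z hz => hmin hz
  set K' := max K L with hK'
  have hK2 : ∀ z, K' ≤ z → z ∈ Δ := fun z hz => hK z ((le_max_left _ _).trans hz)
  have hLK' : L ≤ K' := le_max_right _ _
  set N := ((Finset.Ico L K').filter (· ∈ Δ)).card with hN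
  have hNle : (N : ℤ) ≤ K' - L := by
    have := Finset.card_filter_le (Finset.Ico L K') (· ∈ Δ)
    rw [Int.card_Ico] at this
    omega
  refine ⟨K' - N, ?_⟩
  set k := K' - N with hk
  have h1 : {a : ℤ | 0 ≤ a ∧ a ∉ {z | z + k ∈ Δ}}.encard =
      ((Finset.Ico k K').filter (· ∉ Δ)).card := by
    rw [← Set.encard_coe_eq_coe_finsetCard,
      ← (add_left_injective k).encard_image {a : ℤ | 0 ≤ a ∧ a ∉ {z | z + k ∈ Δ}}]
    congr 1
    ext z
    simp only [Set.mem_image, Set.mem_ofPred_eq, Finset.coe_filter, Finset.mem_Ico]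
    constructor
    · rintro ⟨y, ⟨hy0, hy⟩, rfl⟩
      exact ⟨⟨by omega, not_le.1 fun h => hy (hK2 _ h)⟩, hy⟩
    · rintro ⟨⟨hz1, hz2⟩, hz⟩
      exact ⟨z - k, ⟨by omega, by simpa using hz⟩, by ring⟩
  have h2 : {a : ℤ | a < 0 ∧ a ∈ {z | z + k ∈ Δ}}.encard =
      ((Finset.Ico L k).filter (· ∈ Δ)).card := by
    rw [← Set.encard_coe_eq_coe_finsetCard,
      ← (add_left_injective k).encard_image {a : ℤ | a < 0 ∧ a ∈ {z | z + k ∈ Δ}}]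
    congr 1
    ext z
    simp only [Set.mem_image, Set.mem_ofPred_eq, Finset.coe_filter, Finset.mem_Ico]
    constructor
    · rintro ⟨y, ⟨hy0, hy⟩, rfl⟩
      exact ⟨⟨hLK _ hy, by omega⟩, hy⟩
    · rintro ⟨⟨hz1, hz2⟩, hz⟩
      exact ⟨z - k, ⟨by omega, by simpa using hz⟩, by ring⟩
  rw [IsZeroBalanced, h1, h2]
  congr 1
  have h3 := Finset.card_filter_add_card_filter_not (s := Finset.Ico k K') (· ∈ Δ)
  rw [Int.card_Ico] at h3
  have h4 : ((Finset.Ico L k).filter (· ∈ Δ)).card + ((Finset.Ico k K').filter (· ∈ Δ)).card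
      = N := by
    rw [hN, ← Finset.Ico_union_Ico_eq_Ico (show L ≤ k by omega) (show k ≤ K' by omega),
      Finset.filter_union, Finset.card_union_of_disjoint]
    exact Finset.disjoint_filter_filter (Finset.Ico_disjoint_Ico_consecutive L k K')
  omega

theorem mem_generatorSet_translate {k : ℕ} {Δ : Set ℤ} {t z : ℤ} :
    z ∈ generatorSet k {z | z + t ∈ Δ} ↔ z + t ∈ generatorSet k Δ := by
  simp only [generatorSet, Set.mem_ofPred_eq]
  rw [show z - k + t = z + t - k by ring]

theorem mem_cogeneratorSet_translate {k : ℕ} {Δ : Set ℤ} {t z : ℤ} :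
    z ∈ cogeneratorSet k {z | z + t ∈ Δ} ↔ z + t ∈ cogeneratorSet k Δ := by
  simp only [cogeneratorSet, Set.mem_ofPred_eq]
  rw [show z + k + t = z + t + k by ring]

theorem IsBCInvariantSet.translate {m n : ℕ} {Δ : Set ℤ} (h : IsBCInvariantSet m n Δ) (t : ℤ) :
    IsBCInvariantSet m n {z | z + t ∈ Δ} where
  invariant_left z hz := by
    have := h.invariant_left _ hz
    rwa [add_right_comm] at this
  invariant_right z hz := by
    have := h.invariant_right _ hz
    rwa [add_right_comm] at this
  bounded := by
    obtain ⟨b, hb, hmin⟩ := h.bounded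
    refine ⟨b - t, by simpa using hb, fun z hz => ?_⟩
    have := hmin hz
    omega
  cobounded := by
    obtain ⟨K, hK⟩ := h.cobounded
    exact ⟨K - t, fun z hz => hK _ (by omega)⟩

/-- A bounded and co-bounded `(d * m, d * n)`-invariant set decomposes as the union of
`d * Θ r + X r` for `0`-balanced `(m, n)`-invariant sets `Θ r`, with `X r` in the residue class of
`r` modulo `d`. -/
theorem exists_balanced_decomposition {d m n : ℕ} (hd : 0 < d) {Δ : Set ℤ}
    (h : IsBCInvariantSet (d * m) (d * n) Δ) :
    ∃ (Θ : Fin d → Set ℤ) (X : Fin d → ℤ), IsBalancedTuple m n Θ ∧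
      (∀ r, X r % (d : ℤ) = (r : ℕ)) ∧
      (∀ r z, z ∈ Θ r ↔ (d : ℤ) * z + X r ∈ Δ) ∧
      ∀ r z, z ∈ skeletonSet m n (Θ r) ↔ (d : ℤ) * z + X r ∈ skeletonSet (d * m) (d * n) Δ := by
  have hpart := fun r : Fin d => h.residuePart hd ((r : ℕ) : ℤ)
  choose k hk using fun r : Fin d =>
    exists_isZeroBalanced_translate (hpart r).bounded (hpart r).cobounded
  refine ⟨fun r => {z | z + k r ∈ residuePart d ((r : ℕ) : ℤ) Δ},
    fun r => (d : ℤ) * k r + ((r : ℕ) : ℤ), fun r => ⟨(hpart r).translate _, hk r⟩, fun r => ?_,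
    fun r z => ?_, fun r z => ?_⟩
  · rw [Int.mul_add_emod_self_left]
    exact Int.emod_eq_of_lt (by positivity) (by exact_mod_cast r.2)
  · rw [Set.mem_ofPred_eq, mem_residuePart, mul_add, add_assoc]
  · rw [← add_assoc, ← mul_add, ← mem_skeletonSet_residuePart]
    simp only [skeletonSet, Set.mem_union, mem_generatorSet_translate,
      mem_cogeneratorSet_translate]

theorem correspondsToShift_sub {d : ℕ} {Θ : Fin d → Set ℤ} {X : Fin d → ℤ} {Δ : Set ℤ}
    (h : ∀ a, a ∈ Δ ↔ ∃ r, ∃ z ∈ Θ r, a = (d : ℤ) * z + X r) (e : ℝ) :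
    CorrespondsToShift Θ (fun r => (X r : ℝ) - e) Δ := by
  refine ⟨-e, ?_⟩
  ext t
  simp only [shiftUnion, scaledShift, Set.mem_iUnion, Set.mem_image]
  constructor
  · rintro ⟨r, z, hz, rfl⟩
    refine ⟨(d : ℤ) * z + X r, (h _).2 ⟨r, z, hz, rfl⟩, ?_⟩
    push_cast
    ring
  · rintro ⟨a, ha, rfl⟩
    obtain ⟨r, z, hz, rfl⟩ := (h a).1 ha
    refine ⟨r, z, hz, ?_⟩
    push_cast
    ring

theorem sub_mean_mem_shiftSpace {d : ℕ} (hd : 0 < d) (X : Fin d → ℝ) :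
    (fun r => X r - (∑ i, X i) / d) ∈ shiftSpace d := by
  have : (d : ℝ) ≠ 0 := by exact_mod_cast hd.ne'
  simp only [shiftSpace, Set.mem_ofPred_eq, Finset.sum_sub_distrib, Finset.sum_const,
    Finset.card_univ, Fintype.card_fin, nsmul_eq_mul]
  field_simp
  ring

/-- If the points of the shifted skeletons lie in the same strict order for two shifts `x` and
`y`, the order is kept along the segment from `x` to `y`, so this segment avoids the arrangement. -/
theorem sameRegion_of_order {m n d : ℕ} {Θ : Fin d → Set ℤ} {x y : Fin d → ℝ}
    (hx : x ∈ shiftSpace d) (hy : y ∈ shiftSpace d)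
    (h : ∀ i j, i ≠ j → ∀ s ∈ skeletonSet m n (Θ i), ∀ t ∈ skeletonSet m n (Θ j),
      ((d : ℝ) * s + x i < d * t + x j ∧ (d : ℝ) * s + y i < d * t + y j) ∨
      ((d : ℝ) * t + x j < d * s + x i ∧ (d : ℝ) * t + y j < d * s + y i)) :
    SameRegion m n Θ x y := by
  have hseg : segment ℝ x y ⊆ shiftSpace d \ shiftArrangement m n Θ := by
    rintro _ ⟨α, β, hα, hβ, hαβ, rfl⟩
    refine ⟨?_, ?_⟩
    · simp only [shiftSpace, Set.mem_ofPred_eq] at hx hy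
      simp [shiftSpace, Finset.sum_add_distrib, ← Finset.mul_sum, hx, hy]
    · rintro ⟨-, i, j, hij, u, ⟨s, hs, rfl⟩, t, ht, hst⟩
      simp only [Pi.add_apply, Pi.smul_apply, smul_eq_mul] at hst
      have hmix : ∀ p q p' q' : ℝ, p < q → p' < q' → α * p + β * p' < α * q + β * q' := by
        intro p q p' q' h1 h2
        rcases hα.eq_or_lt with rfl | hα'
        · obtain rfl : β = 1 := by linarith
          linarith
        · nlinarith [mul_pos hα' (sub_pos.2 h1), mul_nonneg hβ (sub_pos.2 h2).le]
      have e1 : ∀ w : ℝ, w = α * w + β * w := fun w => by rw [← add_mul, hαβ, one_mul]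
      have e2 := e1 ((d : ℝ) * s)
      have e3 := e1 ((d : ℝ) * t)
      rcases h i j hij s hs t ht with ⟨h1, h2⟩ | ⟨h1, h2⟩
      · have := hmix _ _ _ _ h1 h2
        linarith
      · have := hmix _ _ _ _ h1 h2
        linarith
  exact ⟨hseg (left_mem_segment ℝ x y),
    (convex_segment x y).isPreconnected.subset_connectedComponentIn (left_mem_segment ℝ x y) hseg
      (right_mem_segment ℝ x y)⟩

/-- Translating the parts of `Δ` in the residue classes modulo `gcd m n` without changing the order
of the skeleton gives an equivalent set. -/
theorem gmvEquivalent_of_residue_shift {m n : ℕ} (hm : 0 < m) {Δ Δ' : Set ℤ}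
    (hΔ : IsBCInvariantSet m n Δ) {v : ℤ → ℤ}
    (hv : ∀ x, x ∈ Δ' ↔ ∃ y ∈ Δ, x = y + v (y % (Nat.gcd m n : ℤ)))
    (hord : ∀ s ∈ skeletonSet m n Δ, ∀ t ∈ skeletonSet m n Δ, s < t →
      s + v (s % (Nat.gcd m n : ℤ)) < t + v (t % (Nat.gcd m n : ℤ))) :
    GMVEquivalent m n Δ Δ' := by
  have hd0 : 0 < Nat.gcd m n := Nat.gcd_pos_of_pos_left n hm
  have hm' : Nat.gcd m n * (m / Nat.gcd m n) = m := Nat.mul_div_cancel' (Nat.gcd_dvd_left m n)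
  have hn' : Nat.gcd m n * (n / Nat.gcd m n) = n := Nat.mul_div_cancel' (Nat.gcd_dvd_right m n)
  unfold GMVEquivalent
  generalize m / Nat.gcd m n = m' at *
  generalize n / Nat.gcd m n = n' at *
  generalize Nat.gcd m n = d at *
  subst hm' hn'
  obtain ⟨Θ, X, hΘ, hX, hmem, hskel⟩ := exists_balanced_decomposition hd0 hΔ
  have hmod : ∀ r z, ((d : ℤ) * z + X r) % (d : ℤ) = (r : ℕ) := fun r z => by
    rw [Int.mul_add_emod_self_left, hX]
  have hcover : ∀ a ∈ Δ, ∃ r, ∃ z ∈ Θ r, a = (d : ℤ) * z + X r := by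
    intro a ha
    have hdz : (0 : ℤ) < d := by exact_mod_cast hd0
    have hr0 := Int.emod_nonneg a hdz.ne'
    have hr1 := Int.emod_lt_of_pos a hdz
    set r : Fin d := ⟨(a % d).toNat, by omega⟩ with hr
    have hra : a % d = X r % d := by
      rw [hX, hr]
      exact (Int.toNat_of_nonneg hr0).symm
    obtain ⟨z, hz⟩ := Int.ModEq.dvd (show X r ≡ a [ZMOD d] from hra.symm)
    have haz : a = (d : ℤ) * z + X r := by linarith
    exact ⟨r, z, (hmem r z).2 (haz ▸ ha), haz⟩
  set Y : Fin d → ℤ := fun r => X r + v (r : ℕ) with hY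
  have hYv : ∀ r z, (d : ℤ) * z + X r + v (((d : ℤ) * z + X r) % d) = d * z + Y r := fun r z => by
    rw [hmod, hY, add_assoc]
  set e := (∑ i, (X i : ℝ)) / d with he
  set e' := (∑ i, (Y i : ℝ)) / d with he'
  refine ⟨Θ, fun r => X r - e, fun r => Y r - e', hΘ, correspondsToShift_sub (fun a => ?_) e,
    correspondsToShift_sub (fun a => ?_) e',
    sameRegion_of_order (sub_mean_mem_shiftSpace hd0 _) (sub_mean_mem_shiftSpace hd0 _) ?_⟩
  · refine ⟨hcover a, ?_⟩
    rintro ⟨r, z, hz, rfl⟩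
    exact (hmem r z).1 hz
  · rw [hv]
    constructor
    · rintro ⟨b, hb, rfl⟩
      obtain ⟨r, z, hz, rfl⟩ := hcover b hb
      exact ⟨r, z, hz, hYv r z⟩
    · rintro ⟨r, z, hz, rfl⟩
      exact ⟨_, (hmem r z).1 hz, (hYv r z).symm⟩
  · intro i j hij s hs t ht
    have hs' := (hskel i s).1 hs
    have ht' := (hskel j t).1 ht
    have hcast : ∀ (Z : Fin d → ℤ) (f : ℝ) (i j : Fin d) (s t : ℤ),
        (d : ℤ) * s + Z i < d * t + Z j → (d : ℝ) * s + (Z i - f) < d * t + (Z j - f) := by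
      intro Z f i j s t hlt
      have : ((d : ℤ) * s + Z i : ℝ) < (d : ℤ) * t + Z j := by exact_mod_cast hlt
      push_cast at this
      linarith
    rcases lt_trichotomy ((d : ℤ) * s + X i) (d * t + X j) with hlt | heq | hlt
    · have := hord _ hs' _ ht' hlt
      rw [hYv, hYv] at this
      exact Or.inl ⟨hcast X e _ _ _ _ hlt, hcast Y e' _ _ _ _ this⟩
    · -- Distinct components lie in distinct residue classes.
      have h1 := hmod i s
      rw [heq, hmod] at h1
      exact (hij (Fin.ext (by exact_mod_cast h1.symm))).elim
    · have := hord _ ht' _ hs' hlt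
      rw [hYv, hYv] at this
      exact Or.inr ⟨hcast X e _ _ _ _ hlt, hcast Y e' _ _ _ _ this⟩

theorem mainTheorem4 (m n : ℕ) (hm : 0 < m) (hn : 0 < n) (Δ Δ' : Set ℤ)
    (hΔ : IsBCInvariantSet m n Δ) (hΔ' : IsBCInvariantSet m n Δ')
    (p : Fin n → Fin m)
    (hp : IsAssociatedMonotoneParking Δ p) (hp' : IsAssociatedMonotoneParking Δ' p) :
    GMVEquivalent m n Δ Δ' := by
  obtain ⟨v, hv, hord⟩ := exists_residue_shift hm hn hΔ hΔ' hp hp'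
  exact gmvEquivalent_of_residue_shift hm hΔ hv hord
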